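/- We work over $\mathbb{C}$. Let $G$ be a reductive (not necessarily connected) algebraic group over $\mathbb{C}$, i.e. an affine group scheme of finite type over $\mathbb{C}$ with trivial unipotent radical. Let $X$ be a projective scheme over $\mathbb{C}$ with a $G$-action, let $\mathcal{M}$ be a $G$-linearized line bundle on $X$, let $x\in X(\mathbb{C})$, and let $\lambda\colon\mathbb{C}^*=\mathbb{G}_m\to G$ be a one parameter subgroup, i.e. a homomorphism of algebraic groups. Write $x_\infty:=\lim_{z\to\infty}\lambda(z)\cdot x$, i.e. the value at $z=\infty$ of the extension of the morphism $\mathbb{C}^*\to X$, $z\mapsto\lambda(z)\cdot x$, to $\mathbb{C}^*\cup\{\infty\}$. If $x_\infty$ exists and is fixed under the $\mathbb{C}^*$-action induced by $\lambda$, and $\mathbb{C}^*$ acts on the fibre $\mathcal{M}\langle x_\infty\rangle$ by the character $z\mapsto z^{\gamma}$, $\gamma\in\mathbb{Z}$, one sets $$\mu_{\mathcal{M}}(\lambda,x):=-\gamma .$$ **Lemma.** Let $G$ be a reductive algebraic group over $\mathbb{C}$, let $X$ and $Y$ be projective schemes over $\mathbb{C}$ equipped with $G$-actions, and let $\pi\colon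 X\to Y$ be a finite $G$-equivariant morphism over $\mathbb{C}$. Let $\mathcal{L}$ be a $G$-linearized ample line bundle on $Y$, and give $\pi^*\mathcal{L}$ the induced linearization. Then, for every point $x\in X(\mathbb{C})$ and every one parameter subgroup $\lambda\colon\mathbb{C}^*\to G$, the integers $\mu_{\pi^*\mathcal{L}}(\lambda,x)$ and $\mu_{\mathcal{L}}(\lambda,\pi(x))$ are well defined (each exists and is unique), and $$\mu_{\pi^*\mathcal{L}}(\lambda,x)=\mu_{\mathcal{L}}(\lambda,\pi(x)).$$ -/

import Mathlib

open CategoryTheory AlgebraicGeometry MonoidalCategory CartesianMonoidalCategory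
open scoped Topology MonObj LaurentPolynomial Polynomial

noncomputable section

namespace GIT

/-! ### Schemes over the complex numbers -/

/-- `Spec ℂ`. -/
abbrev SpecC : Scheme.{0} := Spec (.of ℂ)

/-- The category of schemes over `Spec ℂ`. -/
abbrev SchC : Type 1 := Over SpecC

/-- The set `X(ℂ)` of complex points of `X`. -/
abbrev Points (X : SchC) : Type := 𝟙_ SchC ⟶ X

attribute [local instance] MvPolynomial.gradedAlgebra

/-- The structure morphism of `ℙⁿ = Proj ℂ[x₀, …, xₙ]` over `Spec ℂ`. -/
def projToSpec (n : ℕ) :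
    Proj (MvPolynomial.homogeneousSubmodule (Fin (n + 1)) ℂ) ⟶ SpecC :=
  Proj.toSpecZero (MvPolynomial.homogeneousSubmodule (Fin (n + 1)) ℂ) ≫
    Spec.map (CommRingCat.ofHom
      (algebraMap ℂ (MvPolynomial.homogeneousSubmodule (Fin (n + 1)) ℂ 0)))

/-- `X` is a projective scheme: it is isomorphic over `ℂ` to a closed subscheme of some `ℙⁿ`. -/
def IsProjective (X : SchC) : Prop :=
  ∃ (n : ℕ) (i : X.left ⟶ Proj (MvPolynomial.homogeneousSubmodule (Fin (n + 1)) ℂ)),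
    IsClosedImmersion i ∧ i ≫ projToSpec n = X.hom

/-! ### Reductive groups -/

section Reductive

variable (G : SchC) [GrpObj G]

/-- The value `f(g) ∈ ℂ` of a regular function `f` on `G` at a complex point `g`. -/
def evalAt {G : SchC} (f : Γ(G.left, ⊤)) (g : Points G) : ℂ :=
  (Scheme.ΓSpecIso (.of ℂ)).hom (Scheme.Hom.appTop (X := SpecC) g.left f)

/-- A representation of the group `G(ℂ)` on `ℂⁿ` is rational if its matrix coefficients are
regular functions on `G`. -/
def IsRational {n : ℕ} (ρ : Representation ℂ (Points G) (Fin n → ℂ)) : Prop :=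
  ∀ (v : Fin n → ℂ) (i : Fin n), ∃ f : Γ(G.left, ⊤), ∀ g : Points G, evalAt f g = ρ g v i

/-- `g ∈ G(ℂ)` is unipotent: it acts unipotently in every rational representation. -/
def IsUnipotent (g : Points G) : Prop :=
  ∀ (n : ℕ) (ρ : Representation ℂ (Points G) (Fin n → ℂ)), IsRational G ρ →
    IsNilpotent (ρ g - 1)

/-- The Zariski topology on `G(ℂ)`. -/
abbrev zariskiTopology : TopologicalSpace (Points G) :=
  TopologicalSpace.induced (fun g : Points G => g.left (IsLocalRing.closedPoint ℂ)) inferInstance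

/-- `G` is a reductive (not necessarily connected) algebraic group over `ℂ`: an affine group
scheme of finite type with trivial unipotent radical, i.e. whose only Zariski closed, connected,
normal subgroup that consists of unipotent elements is the trivial one. -/
structure IsReductive : Prop where
  affine : IsAffine G.left
  finiteType : LocallyOfFiniteType G.hom
  unipotentRadical : ∀ N : Subgroup (Points G), N.Normal →
    IsClosed[zariskiTopology G] (N : Set (Points G)) →
    @IsConnected _ (zariskiTopology G) (N : Set (Points G)) →
    (∀ g ∈ N, IsUnipotent G g) → N = ⊥

end Reductive

/-! ### Line bundles and ampleness -/

section LineBundle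

variable {X : Scheme.{0}}

/-- A line bundle: an `𝒪_X`-module that is locally isomorphic to `𝒪_X`. -/
def IsLineBundle (L : X.Modules) : Prop :=
  ∀ x : X, ∃ U : X.Opens, x ∈ U ∧
    Nonempty (L.restrict U.ι ≅ SheafOfModules.unit U.toScheme.ringCatSheaf)

/-- The tensor product of `𝒪_X`-modules: the sheaf associated with `U ↦ M(U) ⊗ N(U)`. -/
def tensor (M N : X.Modules) : X.Modules :=
  (PresheafOfModules.sheafification (𝟙 X.ringCatSheaf.obj)).obj
    (PresheafOfModules.Monoidal.tensorObj (R := X.presheaf) M.val N.val)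

/-- `tensorPow L n` is `L^{⊗ n}`. -/
def tensorPow (L : X.Modules) : ℕ → X.Modules
  | 0 => SheafOfModules.unit X.ringCatSheaf
  | n + 1 => tensor (tensorPow L n) L

/-- The open set `X_s` on which the global section `s` of the line bundle `M` does not vanish:
the largest open set on which `f ↦ f • s` is an isomorphism `𝒪_X → M`. -/
def nonvanishing (M : X.Modules) (s : Γ(M, ⊤)) : X.Opens :=
  sSup {U | ∀ V : X.Opens, V ≤ U →
    Function.Bijective fun f : Γ(X, V) =>
      f • M.presheaf.map (homOfLE (le_top : V ≤ ⊤)).op s}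

/-- A line bundle on a quasi-compact scheme is ample if the affine open sets `X_s`, for `s` a
section of a positive power of `L`, cover `X`. -/
structure IsAmple (L : X.Modules) : Prop where
  lineBundle : IsLineBundle L
  compact : CompactSpace X
  exists_section : ∀ x : X, ∃ (n : ℕ) (s : Γ(tensorPow L n, ⊤)), 0 < n ∧
    x ∈ nonvanishing (tensorPow L n) s ∧ IsAffineOpen (nonvanishing (tensorPow L n) s)

end LineBundle

/-! ### Linearizations -/

open Scheme.Modules in
/-- A `G`-linearization of the `𝒪_X`-module `L`, where `G` acts on `X`: for every scheme `T` over
`ℂ`, every `g ∈ G(T)` and every `x, y ∈ X(T)` with `g • x = y`, an isomorphism `x^* L ≅ y^* L`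
(fibrewise, the linear map `L⟨x⟩ → L⟨g • x⟩` by which `g` acts), compatible with base change and
with the multiplication of `G`. -/
structure Linearization (G : SchC) [GrpObj G] {X : SchC} [ModObj G X] (L : X.left.Modules) where
  /-- The action of `g` from `x^* L` to `y^* L`. -/
  act : ∀ {T : SchC} (g : T ⟶ G) (x y : T ⟶ X), g • x = y →
    ((pullback x.left).obj L ≅ (pullback y.left).obj L)
  act_mul : ∀ {T : SchC} (g h : T ⟶ G) (x y z : T ⟶ X) (hxy : h • x = y) (hyz : g • y = z)
    (hxz : (g * h) • x = z), act (g * h) x z hxz = act h x y hxy ≪≫ act g y z hyz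
  act_comp : ∀ {T T' : SchC} (f : T' ⟶ T) (g : T ⟶ G) (x y : T ⟶ X) (hxy : g • x = y)
    (hxy' : (f ≫ g) • (f ≫ x) = f ≫ y),
    (pullback f.left).map (act g x y hxy).hom ≫ (pullbackComp f.left y.left).hom.app L =
      (pullbackComp f.left x.left).hom.app L ≫ (act (f ≫ g) (f ≫ x) (f ≫ y) hxy').hom

namespace Linearization

open Scheme.Modules

variable {G : SchC} [GrpObj G] {X Y : SchC} [ModObj G X] [ModObj G Y]

lemma pullbackComp_assoc {X Y Z T : Scheme.{0}} (f : X ⟶ Y) (g : Y ⟶ Z) (h : Z ⟶ T)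
    (L : T.Modules) :
    (pullbackComp f g).hom.app ((Scheme.Modules.pullback h).obj L) ≫
        (pullbackComp (f ≫ g) h).hom.app L =
      (Scheme.Modules.pullback f).map ((pullbackComp g h).hom.app L) ≫
        (pullbackComp f (g ≫ h)).hom.app L ≫ eqToHom (by rw [Category.assoc]) := by
  have H := congr(($(pseudofunctor_associativity f g h)).app L)
  simp only [NatTrans.comp_app, Functor.whiskerRight_app, Functor.associator_hom_app,
    Functor.whiskerLeft_app, Category.id_comp, eqToHom_app] at H
  rw [← H, ← NatTrans.comp_app_assoc, Iso.hom_inv_id, NatTrans.id_app, Category.id_comp,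
    ← Functor.map_comp_assoc, ← NatTrans.comp_app, Iso.hom_inv_id, NatTrans.id_app]
  simp

lemma act_congr {L : Y.left.Modules} (Φ : Linearization G L) {T : SchC} (g : T ⟶ G)
    {x x' y y' : T ⟶ Y} (hx : x = x') (hy : y = y') (h : g • x = y) (h' : g • x' = y') :
    (Φ.act g x y h).hom =
      eqToHom (by rw [hx]) ≫ (Φ.act g x' y' h').hom ≫ eqToHom (by rw [hy]) := by
  subst hx hy
  simp

lemma pullback_act_comp_aux {T' T X Y : Scheme.{0}} (f : T' ⟶ T) (x y : T ⟶ X) (p : X ⟶ Y)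
    (L : Y.Modules)
    (A : (Scheme.Modules.pullback (x ≫ p)).obj L ⟶ (Scheme.Modules.pullback (y ≫ p)).obj L)
    (A' : (Scheme.Modules.pullback (f ≫ x ≫ p)).obj L ⟶
      (Scheme.Modules.pullback (f ≫ y ≫ p)).obj L)
    (A'' : (Scheme.Modules.pullback ((f ≫ x) ≫ p)).obj L ⟶
      (Scheme.Modules.pullback ((f ≫ y) ≫ p)).obj L)
    (hA : (Scheme.Modules.pullback f).map A ≫ (pullbackComp f (y ≫ p)).hom.app L =
      (pullbackComp f (x ≫ p)).hom.app L ≫ A')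
    (hA' : A'' = eqToHom (by rw [Category.assoc]) ≫ A' ≫ eqToHom (by rw [Category.assoc])) :
    (Scheme.Modules.pullback f).map
        ((pullbackComp x p).hom.app L ≫ A ≫ (pullbackComp y p).inv.app L) ≫
        (pullbackComp f y).hom.app ((Scheme.Modules.pullback p).obj L) =
      (pullbackComp f x).hom.app ((Scheme.Modules.pullback p).obj L) ≫
        (pullbackComp (f ≫ x) p).hom.app L ≫ A'' ≫ (pullbackComp (f ≫ y) p).inv.app L := by
  rw [← cancel_mono ((pullbackComp (f ≫ y) p).hom.app L)]
  simp only [Category.assoc, pullbackComp_assoc, Iso.inv_hom_id_app, Category.comp_id, hA',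
    Functor.map_comp, reassoc_of% pullbackComp_assoc f x p L]
  rw [← Functor.map_comp_assoc ((Scheme.Modules.pullback f)) ((pullbackComp y p).inv.app L),
    Iso.inv_hom_id_app, CategoryTheory.Functor.map_id, Category.id_comp, reassoc_of% hA]
  simp

/-- The linearization of `π^* L` induced by a linearization of `L`, for `π` equivariant: under
`x^* π^* L = (π x)^* L` the action of `g` is the given one. -/
def pullback (π : X ⟶ Y) [IsModHom G π] {L : Y.left.Modules} (Φ : Linearization G L) :
    Linearization G ((Scheme.Modules.pullback π.left).obj L) where
  act g x y hxy :=
    (pullbackComp x.left π.left).app L ≪≫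
      Φ.act g (x ≫ π) (y ≫ π) (by rw [← hxy, IsModHom.map_smul]) ≪≫
      ((pullbackComp y.left π.left).app L).symm
  act_mul g h x y z hxy hyz hxz := by
    rw [Φ.act_mul g h (x ≫ π) (y ≫ π) (z ≫ π) (by rw [← hxy, IsModHom.map_smul])
      (by rw [← hyz, IsModHom.map_smul])]
    ext1
    simp
  act_comp f g x y hxy hxy' := by
    have h := Φ.act_comp f g (x ≫ π) (y ≫ π) (by rw [← hxy, IsModHom.map_smul])
      (by rw [← hxy, IsModHom.map_smul, ModObj.comp_smul])
    exact pullback_act_comp_aux f.left x.left y.left π.left L _ _ _ h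
      (Φ.act_congr (f ≫ g) (Category.assoc f x π) (Category.assoc f y π) _ _)

end Linearization

/-! ### The weight `μ` -/

/-- The multiplicative group `ℂ^* = Spec ℂ[T, T⁻¹]`; its group structure is the one induced by the
Hopf algebra structure of `ℂ[T, T⁻¹]`. -/
abbrev Gm : SchC := (Spec (.of ℂ[T;T⁻¹])).asOver SpecC

/-- The affine line `Spec ℂ[X]`. -/
abbrev A1 : SchC := (Spec (.of ℂ[X])).asOver SpecC

/-- The complex point `z` of `Gm`. -/
def Gm.point (z : ℂˣ) : Points Gm :=
  Over.homMk (Spec.map (CommRingCat.ofHom (LaurentPolynomial.eval₂ (RingHom.id ℂ) z))) <| by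
    change Spec.map _ ≫ Spec.map _ = 𝟙 _
    rw [← Spec.map_comp, ← CommRingCat.ofHom_comp, ← Spec.map_id]
    congr 2
    ext a
    simp

/-- The origin of the affine line. -/
def A1.zero : Points A1 :=
  Over.homMk (Spec.map (CommRingCat.ofHom (Polynomial.evalRingHom (0 : ℂ)))) <| by
    change Spec.map _ ≫ Spec.map _ = 𝟙 _
    rw [← Spec.map_comp, ← CommRingCat.ofHom_comp, ← Spec.map_id]
    congr 2
    ext a
    simp

/-- The open immersion `z ↦ z⁻¹` of `Gm` into the affine line; the origin of the affine line
corresponds to `z = ∞`. -/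
def Gm.inv : Gm ⟶ A1 :=
  Over.homMk (Spec.map (CommRingCat.ofHom
    (Polynomial.eval₂RingHom LaurentPolynomial.C (LaurentPolynomial.T (-1))))) <| by
    change Spec.map _ ≫ Spec.map _ = Spec.map _
    rw [← Spec.map_comp, ← CommRingCat.ofHom_comp]
    congr 2
    ext a
    simp [LaurentPolynomial.algebraMap_apply]

section Weight

variable {G : SchC} [GrpObj G] {X : SchC} [ModObj G X]

/-- `x_∞ = lim_{z → ∞} λ(z) • x`: the morphism `Gm → X`, `z ↦ λ(z) • x`, extends to
`z = ∞` with value `x_∞` there. -/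
def IsLimit (l : Gm ⟶ G) (x xinf : Points X) : Prop :=
  ∃ σ : A1 ⟶ X, Gm.inv ≫ σ = l • (toUnit Gm ≫ x) ∧ A1.zero ≫ σ = xinf

/-- The pullback `x^* L` of `L` to `Spec ℂ` along a complex point `x`. -/
abbrev fibreSheaf (L : X.left.Modules) (x : Points X) : SpecC.Modules :=
  (Scheme.Modules.pullback x.left).obj L

/-- A complex number as a regular function on `Spec ℂ`. -/
abbrev scalar (a : ℂ) : Γ(SpecC, ⊤) := (Scheme.ΓSpecIso (.of ℂ)).inv a

/-- The fibre `L⟨x⟩` of `L` at a complex point `x`: the module of global sections of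
`x^* L` over `Γ(Spec ℂ, 𝒪) = ℂ`. -/
abbrev fibre (L : X.left.Modules) (x : Points X) : Type :=
  Γ(fibreSheaf L x, (⊤ : SpecC.Opens))

variable {L : X.left.Modules}

/-- The point `x` is fixed under `λ`, and `ℂ^*` acts on the fibre `L⟨x⟩` by `z ↦ z ^ c`. -/
def HasWeight (Φ : Linearization G L) (l : Gm ⟶ G) (x : Points X) (c : ℤ) : Prop :=
  ∀ z : ℂˣ, ∃ h : (Gm.point z ≫ l) • x = x, ∀ s : fibre L x,
    (Φ.act (Gm.point z ≫ l) x x h).hom.app ⊤ s = scalar ((z ^ c : ℂˣ) : ℂ) • s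

/-- `m` is a value of `μ_L(λ, x)`: `m = -c`, where `ℂ^*` acts on the fibre of `L` at
`x_∞ = lim_{z → ∞} λ(z) • x` by `z ↦ z ^ c`. -/
def HasMu (Φ : Linearization G L) (l : Gm ⟶ G) (x : Points X) (m : ℤ) : Prop :=
  ∃ (xinf : Points X) (c : ℤ), IsLimit l x xinf ∧ HasWeight Φ l xinf c ∧ m = -c

/-- The number `μ_L(λ, x)`. -/
def mu (Φ : Linearization G L) (l : Gm ⟶ G) (x : Points X) : ℤ :=
  Classical.epsilon (HasMu Φ l x)

end Weight

end GIT

end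

/-! Everything reduces to one point: a limit `y` of `λ(z) • x` in `X`. Since `X` is proper, `z ↦
λ(z) • x` extends over `∞` by the valuative criterion (`exists_extension_inv`), and separatedness
makes the extension unique. Equivariance carries the extension to one for `π(x)`, so the limit there
is `π(y)`. Comparing two extensions of `t ↦ λ(zt) • x` shows that limits are fixed
(`IsLimit.point_smul`).

At the fixed point `π(y)` the universal point of `Gm` acts on a trivial line bundle over `Gm`, hence
by a unit of `ℂ[T;T⁻¹]`. Such a unit is `a T^c`, and multiplicativity at `z = 1` forces `a = 1`;
this is the weight (`exists_hasWeight`). The exponent is determined by the action of `z = 2`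
(`HasWeight.unique`). Finally, the fibre of `π^* L` at `y` is equivariantly the fibre of `L` at
`π(y)` (`HasWeight.pullback`), so both sides have the same weight `c` and both numbers are `-c`. -/

noncomputable section

namespace GIT

/-! ### Endomorphisms and pullbacks of trivial line bundles -/

section Modules

variable {X Y : Scheme.{0}}

/-- Multiplication by a global function, as an endomorphism of an `𝒪_X`-module. -/
def smulEnd (M : X.Modules) (u : Γ(X, ⊤)) : M ⟶ M :=
  ⟨PresheafOfModules.homMk
    { app := fun U => M.smul (X.presheaf.map (homOfLE (le_top : U.unop ≤ ⊤)).op u)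
      naturality := fun U V i => by
        refine Eq.symm ((M.map_comp_smul i.unop _).trans ?_)
        congr 2
        rw [← CategoryTheory.comp_apply, ← Functor.map_comp]
        rfl }
    (fun U r m => by
      exact smul_comm (M := Γ(X, U.unop)) (N := Γ(X, U.unop)) (α := Γ(M, U.unop)) _ r m)⟩

lemma smulEnd_app (M : X.Modules) (u : Γ(X, ⊤)) (U : X.Opens) (s : Γ(M, U)) :
    (smulEnd M u).app U s = X.presheaf.map (homOfLE (le_top : U ≤ ⊤)).op u • s := rfl

lemma smulEnd_app_top (M : X.Modules) (u : Γ(X, ⊤)) (s : Γ(M, ⊤)) :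
    (smulEnd M u).app ⊤ s = u • s := by
  rw [smulEnd_app]
  congr 1
  exact congr($(X.presheaf.map_id _) u)

lemma smulEnd_naturality {M N : X.Modules} (φ : M ⟶ N) (u : Γ(X, ⊤)) :
    smulEnd M u ≫ φ = φ ≫ smulEnd N u := by
  ext U s
  exact φ.app_smul _ s

lemma smulEnd_mul (M : X.Modules) (u v : Γ(X, ⊤)) :
    smulEnd M (u * v) = smulEnd M v ≫ smulEnd M u := by
  ext U s
  change (_ : Γ(X, U)) • s = (_ : Γ(X, U)) • ((_ : Γ(X, U)) • s)
  rw [map_mul, mul_smul]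

/-- After transposing along the pullback–pushforward adjunction, this is linearity of the unit `M ⟶
f_* f^* M`, since functions on `Y` act on `f_*` through `f`. -/
lemma pullback_map_smulEnd (f : X ⟶ Y) (M : Y.Modules) (u : Γ(Y, ⊤)) :
    (Scheme.Modules.pullback f).map (smulEnd M u) =
      smulEnd ((Scheme.Modules.pullback f).obj M) (f.appTop u) := by
  let adj := Scheme.Modules.pullbackPushforwardAdjunction f
  apply (adj.homEquiv _ _).injective
  rw [Adjunction.homEquiv_unit, Adjunction.homEquiv_unit]
  refine (adj.unit_naturality (smulEnd M u)).trans ?_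
  ext U s
  refine ((adj.unit.app M).app_smul (Y.presheaf.map (homOfLE (le_top : U ≤ ⊤)).op u) s).trans ?_
  let t : Γ((Scheme.Modules.pullback f).obj M, f ⁻¹ᵁ U) := (adj.unit.app M).app U s
  change f.app U (Y.presheaf.map (homOfLE (le_top : U ≤ ⊤)).op u) • t =
    (_ : Γ(X, f ⁻¹ᵁ U)) • t
  congr 1
  exact congr($(f.naturality (homOfLE (le_top : U ≤ ⊤)).op) u)

/-- The structure sheaf as a module over itself. -/
abbrev structureModule (X : Scheme.{0}) : X.Modules := SheafOfModules.unit X.ringCatSheaf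

/-- The section `1` of the structure sheaf. -/
def oneSection (U : X.Opens) : Γ(structureModule X, U) := (1 : Γ(X, U))

lemma exists_smul_oneSection {U : X.Opens} (s : Γ(structureModule X, U)) :
    ∃ r : Γ(X, U), s = r • oneSection U :=
  ⟨s, (mul_one (M := Γ(X, U)) s).symm⟩

lemma smul_oneSection_injective {U : X.Opens} {r r' : Γ(X, U)}
    (h : r • oneSection U = r' • oneSection U) : r = r' :=
  ((mul_one r).symm.trans h).trans (mul_one r')

lemma map_oneSection {U V : X.Opens} (i : U ⟶ V) :
    (structureModule X).presheaf.map i.op (oneSection V) = oneSection U :=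
  map_one (X.presheaf.map i.op).hom

/-- An endomorphism of `𝒪_X` is determined by the image `u` of the global section `1`, because `1`
restricts to a generator over every open set. -/
lemma exists_eq_smulEnd_structureModule (A : structureModule X ⟶ structureModule X) :
    ∃ u, A = smulEnd _ u := by
  obtain ⟨u, hu⟩ := exists_smul_oneSection (A.app ⊤ (oneSection ⊤))
  refine ⟨u, ?_⟩
  apply Scheme.Modules.hom_ext
  intro U
  ext s
  obtain ⟨r, rfl⟩ := exists_smul_oneSection s
  have h := congr($(A.mapPresheaf.naturality (homOfLE (le_top : U ≤ ⊤)).op) (oneSection ⊤))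
  replace h : A.app U ((structureModule X).presheaf.map (homOfLE (le_top : U ≤ ⊤)).op
    (oneSection ⊤)) = (structureModule X).presheaf.map (homOfLE (le_top : U ≤ ⊤)).op
      (A.app ⊤ (oneSection ⊤)) := h
  rw [hu, Scheme.Modules.map_smul, map_oneSection] at h
  rw [smulEnd_app, Scheme.Modules.Hom.app_smul, h, smul_comm]

lemma exists_eq_smulEnd {M : X.Modules} (e : M ≅ structureModule X)
    (A : M ⟶ M) : ∃ u, A = smulEnd _ u := by
  obtain ⟨u, hu⟩ := exists_eq_smulEnd_structureModule (e.inv ≫ A ≫ e.hom)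
  refine ⟨u, ?_⟩
  rw [← cancel_epi e.inv, ← cancel_mono e.hom, Category.assoc, hu, ← smulEnd_naturality,
    Category.assoc, e.inv_hom_id, Category.comp_id]

lemma smulEnd_injective {M : X.Modules} (e : M ≅ structureModule X)
    {u v : Γ(X, ⊤)} (h : smulEnd M u = smulEnd M v) : u = v := by
  have h' : smulEnd (structureModule X) u = smulEnd (structureModule X) v := by
    rw [← cancel_epi e.hom, ← smulEnd_naturality, h, smulEnd_naturality]
  apply smul_oneSection_injective
  rw [← smulEnd_app_top, h', smulEnd_app_top]

lemma smulEnd_one (M : X.Modules) : smulEnd M 1 = 𝟙 M := by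
  ext U s
  change (_ : Γ(X, U)) • s = s
  rw [map_one, one_smul]

lemma isUnit_of_eq_smulEnd {M : X.Modules} (e : M ≅ structureModule X)
    (A : M ≅ M) {u : Γ(X, ⊤)} (h : A.hom = smulEnd M u) : IsUnit u := by
  obtain ⟨v, hv⟩ := exists_eq_smulEnd e A.inv
  refine IsUnit.of_mul_eq_one v (smulEnd_injective e ?_)
  rw [smulEnd_mul, ← h, ← hv, A.inv_hom_id, smulEnd_one]

/-- Each category of opens `U` of `Y` with `V ≤ f⁻¹ U` has the terminal object `⊤`, hence is
connected. Finality is what makes the comparison `f^* 𝒪_Y ⟶ 𝒪_X` an isomorphism. -/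
instance final_opensMap (f : X ⟶ Y) : (TopologicalSpace.Opens.map f.base).Final where
  out V := by
    have h : Limits.IsTerminal (StructuredArrow.mk
        (homOfLE le_top : V ⟶ (TopologicalSpace.Opens.map f.base).obj ⊤)) :=
      Limits.IsTerminal.ofUniqueHom (fun A => StructuredArrow.homMk (homOfLE le_top) rfl)
        (fun A m => by ext; exact Subsingleton.elim _ _)
    have := h.hasTerminal
    exact isConnected_of_hasTerminal _

/-- The pullback of the structure sheaf is the structure sheaf. -/
def pullbackStructureModuleIso (f : X ⟶ Y) :
    (Scheme.Modules.pullback f).obj (structureModule Y) ≅ structureModule X :=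
  haveI : (SheafOfModules.pushforward f.toRingCatSheafHom).IsRightAdjoint :=
    inferInstanceAs ((Scheme.Modules.pushforward f).IsRightAdjoint)
  haveI : IsIso (SheafOfModules.pullbackObjUnitToUnit f.toRingCatSheafHom) := by
    exact SheafOfModules.instIsIsoPullbackObjUnitToUnitOfFinal _
  let e := asIso (SheafOfModules.pullbackObjUnitToUnit f.toRingCatSheafHom)
  ⟨e.hom, e.inv, e.hom_inv_id, e.inv_hom_id⟩

/-- The pullback of a line bundle to `Spec ℂ` is trivial. -/
lemma exists_pullback_iso_structureModule {L : Y.Modules} (hL : IsLineBundle L) (f : SpecC ⟶ Y) :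
    Nonempty ((Scheme.Modules.pullback f).obj L ≅ structureModule SpecC) := by
  obtain ⟨U, hU, ⟨e⟩⟩ := hL (f (IsLocalRing.closedPoint ℂ))
  -- `Spec ℂ` has a single point, so `f` factors through a trivializing open set.
  have hr : Set.range f ⊆ Set.range U.ι := by
    rintro _ ⟨p, rfl⟩
    rw [Subsingleton.elim p (IsLocalRing.closedPoint ℂ)]
    simpa using hU
  let g := IsOpenImmersion.lift U.ι f hr
  have hg : g ≫ U.ι = f := IsOpenImmersion.lift_fac U.ι f hr
  rw [← hg]
  let e' : (Scheme.Modules.restrictFunctor U.ι).obj L ≅ structureModule U.toScheme :=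
    ⟨e.hom, e.inv, e.hom_inv_id, e.inv_hom_id⟩
  exact ⟨((Scheme.Modules.pullbackComp g U.ι).app L).symm ≪≫
    (Scheme.Modules.pullback g).mapIso
      (((Scheme.Modules.restrictFunctorIsoPullback U.ι).app L).symm ≪≫ e') ≪≫
    pullbackStructureModuleIso g⟩

end Modules

/-! ### Units of Laurent polynomials and translations of `Gm` -/

section MultiplicativeGroup

open LaurentPolynomial in
-- Clearing denominators in `u v = 1` gives `p q = X ^ (n + m)` in the polynomial ring; as `X` is
-- prime, `p` is a constant times a power of `X`.
lemma exists_eq_C_mul_T_of_isUnit {K : Type*} [Field K] {u : K[T;T⁻¹]} (hu : IsUnit u) :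
    ∃ (a : K) (n : ℤ), u = C a * T n := by
  obtain ⟨v, huv⟩ := hu.exists_right_inv
  obtain ⟨n, p, hp⟩ := LaurentPolynomial.exists_T_pow u
  obtain ⟨m, q, hq⟩ := LaurentPolynomial.exists_T_pow v
  have hpq : p * q = Polynomial.X ^ (n + m) := by
    apply Polynomial.toLaurent_injective
    rw [map_mul, hp, hq, Polynomial.toLaurent_X_pow]
    calc u * T n * (v * T m) = u * v * (T n * T m) := by ring
      _ = _ := by rw [huv, one_mul, ← T_add]; push_cast; rfl
  obtain ⟨i, -, w, hi⟩ := (dvd_prime_pow Polynomial.prime_X _).1 (Dvd.intro _ hpq)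
  obtain ⟨b, hb, hbw⟩ := Polynomial.isUnit_iff.1 w⁻¹.isUnit
  have hp' : p = Polynomial.X ^ i * Polynomial.C b := by
    rw [hbw, ← hi, mul_assoc, Units.mul_inv, mul_one]
  refine ⟨b, i - n, ?_⟩
  have : u = Polynomial.toLaurent p * T (-n) := by
    rw [hp, mul_assoc, ← T_add, add_neg_cancel, T_zero, mul_one]
  rw [this, hp', map_mul, Polynomial.toLaurent_X_pow, Polynomial.toLaurent_C, sub_eq_add_neg, T_add]
  ring

/-- The automorphism of `ℂ[T, T⁻¹]` that sends `T` to `z T`. -/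
def laurentScale (z : ℂˣ) : ℂ[T;T⁻¹] →ₐ[ℂ] ℂ[T;T⁻¹] where
  __ := LaurentPolynomial.eval₂ (LaurentPolynomial.C (R := ℂ))
    ((Units.map (LaurentPolynomial.C (R := ℂ)).toMonoidHom z) *
      (LaurentPolynomial.isUnit_T (R := ℂ) 1).unit)
  commutes' a := by
    simp [LaurentPolynomial.algebraMap_apply]

/-- Evaluation of Laurent polynomials at `z`. -/
def laurentEval (z : ℂˣ) : ℂ[T;T⁻¹] →ₐ[ℂ] ℂ where
  __ := LaurentPolynomial.eval₂ (RingHom.id ℂ) z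
  commutes' a := by
    simp [LaurentPolynomial.algebraMap_apply]

lemma laurentEval_T (z : ℂˣ) (n : ℤ) : laurentEval z (LaurentPolynomial.T n) = (z ^ n : ℂˣ) := by
  change LaurentPolynomial.eval₂ (RingHom.id ℂ) z _ = _
  simp

lemma laurentEval_C (z : ℂˣ) (a : ℂ) : laurentEval z (LaurentPolynomial.C a) = a := by
  change LaurentPolynomial.eval₂ (RingHom.id ℂ) z _ = _
  simp

lemma unit_T_one_zpow (n : ℤ) :
    ((LaurentPolynomial.isUnit_T (R := ℂ) 1).unit ^ n : ℂ[T;T⁻¹]ˣ) =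
    (LaurentPolynomial.T n : ℂ[T;T⁻¹]) := by
  induction n using Int.induction_on with
  | zero => simp
  | succ i ih => rw [zpow_add_one, Units.val_mul, ih, LaurentPolynomial.T_add]; rfl
  | pred i ih =>
    rw [← Units.mul_left_inj (LaurentPolynomial.isUnit_T (R := ℂ) 1).unit, ← Units.val_mul,
      ← zpow_add_one, sub_add_cancel, ih]
    change _ = LaurentPolynomial.T _ * LaurentPolynomial.T 1
    rw [← LaurentPolynomial.T_add, sub_add_cancel]

lemma laurentScale_T (z : ℂˣ) (n : ℤ) : laurentScale z (LaurentPolynomial.T n) =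
    LaurentPolynomial.C ((z ^ n : ℂˣ) : ℂ) * LaurentPolynomial.T n := by
  change LaurentPolynomial.eval₂ _ _ _ = _
  rw [LaurentPolynomial.eval₂_T, mul_zpow, ← map_zpow, Units.val_mul,
    unit_T_one_zpow]
  rfl

lemma laurentScale_C (z : ℂˣ) (a : ℂ) : laurentScale z (LaurentPolynomial.C a) =
    LaurentPolynomial.C a := by
  change LaurentPolynomial.eval₂ _ _ _ = _
  simp

lemma laurent_algHom_ext {A : Type*} [CommRing A] [Algebra ℂ A] {f g : ℂ[T;T⁻¹] →ₐ[ℂ] A}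
    (h : ∀ n, f (LaurentPolynomial.T n) = g (LaurentPolynomial.T n)) : f = g :=
  AddMonoidAlgebra.algHom_ext h (Subsingleton.elim _ _)

/-- The monomials `T n` are group-like, so on them the convolution product, which is the group law
on points of `Gm`, is the ordinary product. -/
lemma toConv_mul_toConv_laurent {A : Type*} [CommRing A] [Algebra ℂ A] {f g h : ℂ[T;T⁻¹] →ₐ[ℂ] A}
    (H : ∀ n, f (LaurentPolynomial.T n) * g (LaurentPolynomial.T n) = h (LaurentPolynomial.T n)) :
    WithConv.toConv f * WithConv.toConv g = WithConv.toConv h := by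
  apply WithConv.ofConv_injective
  refine laurent_algHom_ext fun n => Eq.trans ?_ (H n)
  rw [AlgHom.convMul_def]
  simp

/-- Multiplication by `z` on `Gm`. -/
def Gm.scale (z : ℂˣ) : Gm ⟶ Gm :=
  Spec.mapMulEquiv (R := ℂ) (S := ℂ[T;T⁻¹]) (T := ℂ[T;T⁻¹]) (WithConv.toConv (laurentScale z))

lemma Gm.toUnit_comp_point (z : ℂˣ) : toUnit Gm ≫ Gm.point z =
    Spec.mapMulEquiv (R := ℂ) (S := ℂ[T;T⁻¹]) (T := ℂ[T;T⁻¹])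
      (WithConv.toConv ((Algebra.ofId ℂ ℂ[T;T⁻¹]).comp (laurentEval z))) := by
  ext1
  change Spec.map _ ≫ Spec.map _ = Spec.map _
  rw [← Spec.map_comp, ← CommRingCat.ofHom_comp]
  rfl

lemma Gm.toUnit_comp_point_mul_id (z : ℂˣ) :
    (toUnit Gm ≫ Gm.point z) * 𝟙 Gm = Gm.scale z := by
  have hid : 𝟙 Gm = Spec.mapMulEquiv (R := ℂ) (S := ℂ[T;T⁻¹]) (T := ℂ[T;T⁻¹])
      (WithConv.toConv (AlgHom.id ℂ ℂ[T;T⁻¹])) := by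
    ext1
    exact (Spec.map_id _).symm
  rw [Gm.toUnit_comp_point, hid]
  refine (map_mul (Spec.mapMulEquiv (R := ℂ) (S := ℂ[T;T⁻¹]) (T := ℂ[T;T⁻¹])) _ _).symm.trans ?_
  refine congrArg _ ?_
  refine toConv_mul_toConv_laurent fun n => ?_
  rw [laurentScale_T, AlgHom.comp_apply, laurentEval_T]
  rfl

lemma Gm.scale_one : Gm.scale 1 = 𝟙 Gm := by
  have h : laurentScale 1 = AlgHom.id ℂ ℂ[T;T⁻¹] := by
    exact laurent_algHom_ext fun n => (laurentScale_T 1 n).trans (by simp)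
  ext1
  rw [Gm.scale, h]
  exact Spec.map_id _

/-- Idempotence is the only property of the unit point needed to normalize the character in
`exists_hasWeight`. -/
lemma Gm.point_one_mul_point_one : Gm.point 1 * Gm.point 1 = Gm.point 1 := by
  have h := congr(Gm.point 1 ≫ $(Gm.toUnit_comp_point_mul_id 1))
  rw [Gm.scale_one, MonObj.comp_mul] at h
  simpa using h

/-- In the coordinate `1/t` at infinity, scaling `t` by `z` becomes multiplication by `z⁻¹`, which
extends to the affine line and fixes the origin. -/
lemma A1.exists_scale (z : ℂˣ) : ∃ m : A1 ⟶ A1, Gm.inv ≫ m = Gm.scale z ≫ Gm.inv ∧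
    A1.zero ≫ m = A1.zero := by
  let φ : ℂ[X] →ₐ[ℂ] ℂ[X] := Polynomial.aeval (Polynomial.C ((z⁻¹ : ℂˣ) : ℂ) * Polynomial.X)
  refine ⟨(Spec.map (CommRingCat.ofHom φ.toRingHom)).asOver SpecC, ?_, ?_⟩
  · ext1
    change Spec.map _ ≫ Spec.map _ = Spec.map _ ≫ Spec.map _
    rw [← Spec.map_comp, ← Spec.map_comp, ← CommRingCat.ofHom_comp, ← CommRingCat.ofHom_comp]
    congr 2
    apply Polynomial.ringHom_ext
    · intro a
      simp [φ]
      exact (laurentScale_C z a).symm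
    · simp [φ]
      exact ((laurentScale_T z (-1)).trans (by simp)).symm
  · ext1
    change Spec.map _ ≫ Spec.map _ = Spec.map _
    rw [← Spec.map_comp, ← CommRingCat.ofHom_comp]
    congr 2
    apply Polynomial.ringHom_ext
    · intro a
      simp [φ]
    · simp [φ]

end MultiplicativeGroup

/-! ### Properness of projective schemes -/

section Projective

attribute [local instance] MvPolynomial.gradedAlgebra

/-- `Proj` is proper over the spectrum of the degree-zero part because the polynomial ring is of
finite type over it, and that degree-zero part consists of constants. -/
lemma isProper_projToSpec (n : ℕ) : IsProper (projToSpec n) := by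
  let 𝒜 := MvPolynomial.homogeneousSubmodule (Fin (n + 1)) ℂ
  have hfin : Algebra.FiniteType (𝒜 0) (MvPolynomial (Fin (n + 1)) ℂ) :=
    have : IsScalarTower ℂ (𝒜 0) (MvPolynomial (Fin (n + 1)) ℂ) :=
      IsScalarTower.of_algebraMap_eq (R := ℂ) (S := 𝒜 0) (A := MvPolynomial (Fin (n + 1)) ℂ)
        fun _ => rfl
    Algebra.FiniteType.of_restrictScalars_finiteType ℂ _ _
  have h1 : IsProper (Proj.toSpecZero 𝒜) := inferInstance
  have h2 : IsClosedImmersion (Spec.map (CommRingCat.ofHom (algebraMap ℂ (𝒜 0)))) := by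
    apply IsClosedImmersion.spec_of_surjective
    rintro ⟨p, hp⟩
    have hp' : p.IsHomogeneous 0 := hp
    refine ⟨p.coeff 0, Subtype.ext ?_⟩
    exact (MvPolynomial.totalDegree_eq_zero_iff_eq_C.1
      (Nat.le_zero.1 hp'.totalDegree_le)).symm
  exact inferInstanceAs (IsProper (_ ≫ _))

lemma IsProjective.isProper {X : SchC} (hX : IsProjective X) : IsProper X.hom := by
  obtain ⟨n, i, hi, h⟩ := hX
  have := isProper_projToSpec n
  rw [← h]
  infer_instance

end Projective

/-! ### Extending morphisms to proper schemes by the valuative criterion -/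

section Extension

variable {X Y S : Scheme.{0}}

/-- The generic point specializes to `x`, so the value of `f` at the generic point can be read off
from its germ at `x`. -/
lemma fromFunctionField_eq [IrreducibleSpace X] (f : X.PartialMap Y) {x : X} (hx : x ∈ f.domain) :
    f.fromFunctionField =
      Spec.map (X.presheaf.stalkSpecializes ((genericPoint_spec X).specializes trivial)) ≫
        f.fromSpecStalkOfMem hx := by
  rw [Scheme.PartialMap.fromFunctionField, Scheme.PartialMap.fromSpecStalkOfMem,
    Scheme.PartialMap.fromSpecStalkOfMem, ← Category.assoc]
  congr 1
  rw [← cancel_mono f.domain.ι, Category.assoc, Scheme.Opens.fromSpecStalkOfMem_ι,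
    Scheme.Opens.fromSpecStalkOfMem_ι, Scheme.SpecMap_stalkSpecializes_fromSpecStalk]

/-- The existence part of the valuative criterion. -/
lemma exists_lift_of_valuationRing (sY : Y ⟶ S) [UniversallyClosed sY] {R K : CommRingCat.{0}}
    [IsDomain R] [ValuationRing R] (hK : IsField K) (φ : R ⟶ K)
    (h : letI := φ.hom.toAlgebra; IsFractionRing R K) (i₁ : Spec K ⟶ Y) (i₂ : Spec R ⟶ S)
    (w : i₁ ≫ sY = Spec.map φ ≫ i₂) : ∃ l : Spec R ⟶ Y, Spec.map φ ≫ l = i₁ ∧ l ≫ sY = i₂ := by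
  have hval : ValuativeCriterion.Existence sY := by
    have : UniversallyClosed sY := inferInstance
    rw [UniversallyClosed.eq_valuativeCriterion] at this
    exact this.1
  let := φ.hom.toAlgebra
  let := hK.toField
  let sq : ValuativeCommSq sY := { R := R, K := K, i₁ := i₁, i₂ := i₂, commSq := ⟨w⟩ }
  obtain ⟨⟨l, hl₁, hl₂⟩⟩ := (hval sq).exists_lift
  exact ⟨l, hl₁, hl₂⟩

/-- A rational map to a proper scheme is defined at every point whose local ring is a valuation
ring. -/
lemma mem_domain_of_valuationRing [IsIntegral X] (sX : X ⟶ S) (sY : Y ⟶ S) [IsProper sY]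
    (f : X.PartialMap Y) (hf : f.hom ≫ sY = f.domain.ι ≫ sX) (x : X)
    [ValuationRing (X.presheaf.stalk x)] : x ∈ f.toRationalMap.domain := by
  have hK : f.fromFunctionField ≫ sY = X.fromSpecStalk (genericPoint X) ≫ sX := by
    rw [Scheme.PartialMap.fromFunctionField, Scheme.PartialMap.fromSpecStalkOfMem, Category.assoc,
      hf, Scheme.Opens.fromSpecStalkOfMem_ι_assoc]
  obtain ⟨φ, hφ₁, hφ₂⟩ := exists_lift_of_valuationRing sY (R := X.presheaf.stalk x)
    (Field.toIsField X.functionField)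
    (X.presheaf.stalkSpecializes ((genericPoint_spec X).specializes trivial))
    (inferInstanceAs (IsFractionRing (X.presheaf.stalk x) X.functionField))
    f.fromFunctionField (X.fromSpecStalk x ≫ sX) (by
      rw [hK, Scheme.SpecMap_stalkSpecializes_fromSpecStalk_assoc])
  -- The lift over the local ring spreads out to a neighbourhood of `x`. It agrees with `f` at the
  -- generic point, so it represents the same rational map.
  let g := Scheme.PartialMap.ofFromSpecStalk sX sY φ hφ₂
  refine Scheme.RationalMap.mem_domain.2
    ⟨g, Scheme.PartialMap.mem_domain_ofFromSpecStalk sX sY φ hφ₂, ?_⟩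
  apply Scheme.RationalMap.eq_of_fromFunctionField_eq
  rw [Scheme.RationalMap.fromFunctionField_toRationalMap,
    Scheme.RationalMap.fromFunctionField_toRationalMap,
    fromFunctionField_eq g (Scheme.PartialMap.mem_domain_ofFromSpecStalk sX sY φ hφ₂),
    Scheme.PartialMap.fromSpecStalkOfMem_ofFromSpecStalk]
  exact hφ₁

/-- A morphism from a dense open subscheme of an integral scheme all of whose local rings are
valuation rings to a proper scheme extends. -/
lemma exists_extension [IsIntegral X] [∀ x : X, ValuationRing (X.presheaf.stalk x)]
    (sX : X ⟶ S) (sY : Y ⟶ S) [IsProper sY] [S.IsSeparated] {W : Scheme.{0}} [Nonempty W]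
    (j : W ⟶ X) [IsOpenImmersion j] (f : W ⟶ Y) (hf : f ≫ sY = j ≫ sX) :
    ∃ σ : X ⟶ Y, j ≫ σ = f ∧ σ ≫ sY = sX := by
  have : Y.IsSeparated := ⟨by
    rw [← Limits.terminal.comp_from sY]
    infer_instance⟩
  let f₀ : X.PartialMap Y :=
    { domain := j.opensRange
      dense_domain := j.opensRange.isOpen.dense ⟨_, Set.mem_range_self (Classical.arbitrary W)⟩
      hom := j.isoOpensRange.inv ≫ f }
  have hf₀ : f₀.hom ≫ sY = f₀.domain.ι ≫ sX := by
    change (j.isoOpensRange.inv ≫ f) ≫ sY = j.opensRange.ι ≫ sX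
    rw [Category.assoc, hf, ← Category.assoc, Scheme.Hom.isoOpensRange_inv_comp]
  have htop : ⊤ ≤ f₀.toRationalMap.domain := fun x _ =>
    mem_domain_of_valuationRing sX sY f₀ hf₀ x
  obtain ⟨s, hs⟩ : ∃ s : f₀.toRationalMap.domain.toScheme ⟶ Y,
      X.homOfLE f₀.le_domain_toRationalMap ≫ s = f₀.hom :=
    ⟨_, f₀.toPartialMap_toRationalMap_restrict⟩
  let σ : X ⟶ Y := X.topIso.inv ≫ X.homOfLE htop ≫ s
  have hσ : j ≫ σ = f := by
    have hj : j ≫ X.topIso.inv ≫ X.homOfLE htop =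
        j.isoOpensRange.hom ≫ X.homOfLE f₀.le_domain_toRationalMap := by
      rw [← cancel_mono (Scheme.Opens.ι _)]
      simp [f₀]
    calc j ≫ σ = (j ≫ X.topIso.inv ≫ X.homOfLE htop) ≫ s := by
          simp only [σ, Category.assoc]
      _ = j.isoOpensRange.hom ≫ f₀.hom := by rw [hj, Category.assoc, hs]
      _ = f := by simp [f₀]
  refine ⟨σ, hσ, ?_⟩
  have : IsDominant j := ⟨f₀.dense_domain⟩
  apply ext_of_isDominant j
  rw [reassoc_of% hσ, hf]

end Extension

/-! ### The affine line as a completion of `Gm` at infinity -/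

section AffineLine

/-- Every ideal of the localization is extended from `R`, hence principal; a local principal ideal
domain is a valuation ring. -/
lemma valuationRing_of_isLocalization_atPrime {R A : Type*} [CommRing R] [IsDomain R]
    [IsPrincipalIdealRing R] [CommRing A] [IsDomain A] [Algebra R A] (p : Ideal R) [p.IsPrime]
    [IsLocalization.AtPrime A p] : ValuationRing A := by
  have : IsLocalRing A := IsLocalization.AtPrime.isLocalRing A p
  have : IsPrincipalIdealRing A := ⟨fun I => by
    obtain ⟨a, ha⟩ := (IsPrincipalIdealRing.principal (I.under R)).principal
    refine ⟨algebraMap R A a, ?_⟩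
    rw [← IsLocalization.map_under p.primeCompl A I, ha]
    change Ideal.map _ (Ideal.span {a}) = Ideal.span {_}
    rw [Ideal.map_span, Set.image_singleton]⟩
  infer_instance

instance valuationRing_stalk_A1 (p : Spec (.of ℂ[X])) :
    ValuationRing ((Spec (.of ℂ[X])).presheaf.stalk p) := by
  let := (StructureSheaf.toStalk ℂ[X] p).hom.toAlgebra
  have h := StructureSheaf.IsLocalization.to_stalk ℂ[X] p
  have hd : IsDomain ((Spec (.of ℂ[X])).presheaf.stalk p) := inferInstance
  exact @valuationRing_of_isLocalization_atPrime ℂ[X] ((Spec (.of ℂ[X])).presheaf.stalk p)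
    _ _ _ _ hd this (PrimeSpectrum.asIdeal p) (PrimeSpectrum.isPrime p) h

/-- The morphism of schemes underlying `Gm.inv`. -/
abbrev invHom : Spec (.of ℂ[T;T⁻¹]) ⟶ Spec (.of ℂ[X]) := Gm.inv.left

instance isOpenImmersion_inv : IsOpenImmersion invHom := by
  -- The map is the automorphism `T ↦ T⁻¹` followed by the inclusion of the basic open set `X ≠ 0`.
  have h : invHom = Spec.map (CommRingCat.ofHom
      (LaurentPolynomial.invert (R := ℂ)).toRingEquiv.toRingHom) ≫
      Spec.map (CommRingCat.ofHom (algebraMap ℂ[X] ℂ[T;T⁻¹])) := by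
    rw [← Spec.map_comp, ← CommRingCat.ofHom_comp]
    change Spec.map _ = Spec.map _
    congr 2
    apply Polynomial.ringHom_ext <;> simp
  have h1 : IsIso (Spec.map (CommRingCat.ofHom
      (LaurentPolynomial.invert (R := ℂ)).toRingEquiv.toRingHom)) :=
    (Scheme.Spec.mapIso
      (LaurentPolynomial.invert (R := ℂ)).toRingEquiv.toCommRingCatIso.op).isIso_hom
  have h2 : IsOpenImmersion (Spec.map (CommRingCat.ofHom (algebraMap ℂ[X] ℂ[T;T⁻¹]))) :=
    IsOpenImmersion.of_isLocalization (Polynomial.X : ℂ[X])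
  rw [h]
  infer_instance

/-- Morphisms from `Gm` to a proper scheme extend to `z = ∞`. -/
lemma exists_extension_inv {X : SchC} [IsProper X.hom] (f : Gm ⟶ X) :
    ∃ σ : A1 ⟶ X, Gm.inv ≫ σ = f := by
  obtain ⟨σ, hσ, hσ'⟩ := exists_extension (X := Spec (.of ℂ[X])) (W := Spec (.of ℂ[T;T⁻¹]))
    A1.hom X.hom invHom f.left ((Over.w f).trans (Over.w Gm.inv).symm)
  exact ⟨Over.homMk σ hσ', by ext1; exact hσ⟩

instance isDominant_inv : IsDominant invHom :=
  ⟨invHom.opensRange.isOpen.dense ⟨_, Set.mem_range_self (⊥ : PrimeSpectrum ℂ[T;T⁻¹])⟩⟩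

lemma extension_inv_unique {X : SchC} [IsSeparated X.hom] {σ τ : A1 ⟶ X}
    (h : Gm.inv ≫ σ = Gm.inv ≫ τ) : σ = τ := by
  ext1
  exact ext_of_isDominant_of_isSeparated (X := Spec (.of ℂ[X])) X.hom
    ((Over.w σ).trans (Over.w τ).symm) invHom congr(($h).left)

end AffineLine

/-! ### Existence, uniqueness and invariance of limits -/

section Limits

variable {G : SchC} [GrpObj G] {X : SchC} [ModObj G X]

lemma IsLimit.unique [IsSeparated X.hom] {l : Gm ⟶ G} {x y y' : Points X}
    (h : IsLimit l x y) (h' : IsLimit l x y') : y = y' := by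
  obtain ⟨σ, hσ, rfl⟩ := h
  obtain ⟨τ, hτ, rfl⟩ := h'
  rw [extension_inv_unique (hσ.trans hτ.symm)]

lemma exists_isLimit [IsProper X.hom] (l : Gm ⟶ G) (x : Points X) : ∃ y, IsLimit l x y := by
  obtain ⟨σ, hσ⟩ := exists_extension_inv (l • (toUnit Gm ≫ x))
  exact ⟨_, σ, hσ, rfl⟩

lemma IsLimit.comp {Y : SchC} [ModObj G Y] (π : X ⟶ Y) [IsModHom G π] {l : Gm ⟶ G}
    {x y : Points X} (h : IsLimit l x y) : IsLimit l (x ≫ π) (y ≫ π) := by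
  obtain ⟨σ, hσ, rfl⟩ := h
  refine ⟨σ ≫ π, ?_, by rw [Category.assoc]⟩
  rw [reassoc_of% hσ, IsModHom.map_smul, Category.assoc]

/-- The limit point is fixed by the one parameter subgroup. -/
lemma IsLimit.point_smul [IsSeparated X.hom] {l : Gm ⟶ G} [IsMonHom l] {x y : Points X}
    (h : IsLimit l x y) (z : ℂˣ) : (Gm.point z ≫ l) • y = y := by
  obtain ⟨σ, hσ, rfl⟩ := h
  obtain ⟨m, hm, hm0⟩ := A1.exists_scale z
  -- Both sides extend `t ↦ λ(z) • λ(t) • x = λ(zt) • x` over infinity. Evaluating at the origin,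
  -- which `m` fixes, then gives the claim.
  have key : (toUnit A1 ≫ Gm.point z ≫ l) • σ = m ≫ σ := by
    apply extension_inv_unique
    have hl : Gm.inv ≫ toUnit A1 ≫ Gm.point z ≫ l = (toUnit Gm ≫ Gm.point z) ≫ l := by
      rw [← Category.assoc, toUnit_unique (Gm.inv ≫ toUnit A1) (toUnit Gm), Category.assoc]
    rw [ModObj.comp_smul, hσ, hl, ← mul_smul, reassoc_of% hm, hσ, ModObj.comp_smul]
    congr 1
    · rw [← Gm.toUnit_comp_point_mul_id, MonObj.mul_comp, Category.id_comp]
    · rw [← Category.assoc, toUnit_unique (Gm.scale z ≫ toUnit Gm) (toUnit Gm)]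
  have h0 := congr(A1.zero ≫ $key)
  rw [ModObj.comp_smul, reassoc_of% hm0, ← Category.assoc,
    toUnit_unique (A1.zero ≫ toUnit A1) (𝟙 _), Category.id_comp] at h0
  exact h0

end Limits

/-! ### The character of `Gm` on the fibre at a fixed point -/

section Weight

lemma scalar_point_appTop (z : ℂˣ) (u : ℂ[T;T⁻¹]) :
    (Scheme.Hom.appTop (X := SpecC) (Gm.point z).left)
      ((Scheme.ΓSpecIso (.of ℂ[T;T⁻¹])).inv u) = scalar (laurentEval z u) :=
  congr($(Scheme.ΓSpecIso_inv_naturality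
    (CommRingCat.ofHom (LaurentPolynomial.eval₂ (RingHom.id ℂ) z))) u).symm

instance locallyOfFiniteType_Gm : LocallyOfFiniteType Gm.hom :=
  have : Algebra.FiniteType ℂ ℂ[T;T⁻¹] := inferInstance
  locallyOfFiniteType_specOverSpec (R := .of ℂ) (A := .of ℂ[T;T⁻¹])

lemma scalar_injective : Function.Injective scalar :=
  ((Scheme.ΓSpecIso (.of ℂ)).commRingCatIsoToRingEquiv.symm.injective :)

/-- Closed points of `Gm` are complex points. -/
lemma Gm.exists_point (p : Spec (.of ℂ[T;T⁻¹])) (hp : IsClosed {p}) :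
    ∃ z, (Gm.point z).left (IsLocalRing.closedPoint ℂ) = p := by
  let q := pointOfClosedPoint (K := ℂ) Gm.hom p hp
  let ψ := (Spec.preimage q).hom
  have hq : Spec.map (CommRingCat.ofHom ψ) = q := Spec.map_preimage q
  have hψ : ψ.comp (algebraMap ℂ ℂ[T;T⁻¹]) = RingHom.id ℂ := by
    have h : q ≫ Gm.hom = 𝟙 _ := pointOfClosedPoint_comp (K := ℂ) Gm.hom p hp
    rw [← hq] at h
    replace h : Spec.map (CommRingCat.ofHom ψ) ≫
      Spec.map (CommRingCat.ofHom (algebraMap ℂ ℂ[T;T⁻¹])) = 𝟙 _ := h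
    rw [← Spec.map_comp, ← Spec.map_id] at h
    exact congr(($(Spec.map_injective h)).hom)
  let ψ' : ℂ[T;T⁻¹] →ₐ[ℂ] ℂ := { ψ with commutes' := fun a => congr($hψ a) }
  let T₁ := (LaurentPolynomial.isUnit_T (R := ℂ) 1).unit
  -- A complex point is an algebra map `ψ : ℂ[T;T⁻¹] → ℂ`, and `z` is its value on `T`.
  let z : ℂˣ := Units.map ψ.toMonoidHom T₁
  have hz : laurentEval z = ψ' := laurent_algHom_ext fun n => by
    rw [laurentEval_T, ← map_zpow, ← unit_T_one_zpow]
    rfl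
  refine ⟨z, ?_⟩
  have h : (Gm.point z).left = q := by
    rw [← hq]
    change Spec.map (CommRingCat.ofHom (laurentEval z).toRingHom) = _
    rw [hz]
  rw [h]
  exact pointOfClosedPoint_apply (K := ℂ) Gm.hom p hp _

variable {G : SchC} [GrpObj G] {X : SchC} [ModObj G X]

/-- A point fixed by all `λ(z)` is fixed by `λ`. -/
lemma smul_toUnit_comp_eq [IsSeparated X.hom] [LocallyOfFiniteType X.hom] {l : Gm ⟶ G}
    {y : Points X} (h : ∀ z, (Gm.point z ≫ l) • y = y) :
    l • (toUnit Gm ≫ y) = toUnit Gm ≫ y := by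
  have hz (z : ℂˣ) : Gm.point z ≫ (l • (toUnit Gm ≫ y)) = Gm.point z ≫ toUnit Gm ≫ y := by
    have : Gm.point z ≫ toUnit Gm ≫ y = y := by
      rw [← Category.assoc, toUnit_unique (Gm.point z ≫ toUnit Gm) (𝟙 _), Category.id_comp]
    rw [ModObj.comp_smul, this, h]
  ext1
  have hw : (l • (toUnit Gm ≫ y)).left ≫ X.hom = Gm.hom := Over.w (l • (toUnit Gm ≫ y))
  have hft : LocallyOfFiniteType ((l • (toUnit Gm ≫ y)).left ≫ X.hom) := by
    rw [hw]
    infer_instance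
  have hred : IsReduced Gm.left := inferInstanceAs (IsReduced (Spec (.of ℂ[T;T⁻¹])))
  -- `Gm` is reduced and of finite type and `X` is separated, so agreement at closed points
  -- suffices, and these are all of the form `Gm.point z`.
  refine ext_of_apply_eq (K := ℂ) X.hom Set.univ isClosed_univ.isLocallyClosed
    dense_univ (fun p _ hp => ?_) (hw.trans (Over.w (toUnit Gm ≫ y)).symm)
  obtain ⟨z, rfl⟩ := Gm.exists_point p hp
  exact congr(($(hz z)).left (IsLocalRing.closedPoint ℂ))

lemma eq_smulEnd_of_eqToHom {Z : Scheme.{0}} {M N : Z.Modules} (E : M = N) {A : N ⟶ N}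
    {v : Γ(Z, ⊤)} (h : smulEnd M v = eqToHom E ≫ A ≫ eqToHom E.symm) : A = smulEnd N v := by
  subst E
  simpa using h.symm

variable {L : X.left.Modules}

lemma hasWeight_of_eq_smulEnd (Φ : Linearization G L) {l : Gm ⟶ G} {y : Points X} {c : ℤ}
    (h : ∀ z, (Gm.point z ≫ l) • y = y)
    (h' : ∀ z, (Φ.act _ y y (h z)).hom = smulEnd _ (scalar ((z ^ c : ℂˣ) : ℂ))) :
    HasWeight Φ l y c := fun z => ⟨h z, fun s => by rw [h', smulEnd_app_top]⟩

/-- On the fibre of a line bundle at a fixed point, `Gm` acts through a character `z ↦ z ^ c`. -/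
lemma exists_hasWeight (hL : IsLineBundle L) (Φ : Linearization G L) [IsSeparated X.hom]
    [LocallyOfFiniteType X.hom] {l : Gm ⟶ G} [IsMonHom l]
    {y : Points X} (h : ∀ z, (Gm.point z ≫ l) • y = y) : ∃ c, HasWeight Φ l y c := by
  have hl := smul_toUnit_comp_eq h
  -- The action of the universal point of `Gm`; its multiplier `u` is a function on `Gm` whose value
  -- at `z` gives the action of `λ(z)`.
  let A := Φ.act l (toUnit Gm ≫ y) (toUnit Gm ≫ y) hl
  obtain ⟨e⟩ := exists_pullback_iso_structureModule hL y.left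
  let e' : (Scheme.Modules.pullback (toUnit Gm ≫ y).left).obj L ≅ structureModule Gm.left :=
    ((Scheme.Modules.pullbackComp (toUnit Gm).left y.left).app L).symm ≪≫
      (Scheme.Modules.pullback (toUnit Gm).left).mapIso e ≪≫
      pullbackStructureModuleIso (toUnit Gm).left
  obtain ⟨u, hu⟩ := exists_eq_smulEnd e' A.hom
  have hunit := isUnit_of_eq_smulEnd e' A hu
  let u' : ℂ[T;T⁻¹] := (Scheme.ΓSpecIso (.of ℂ[T;T⁻¹])).hom u
  have hu' : IsUnit u' := hunit.map (Scheme.ΓSpecIso (.of ℂ[T;T⁻¹])).hom.hom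
  have hu'' : u = (Scheme.ΓSpecIso (.of ℂ[T;T⁻¹])).inv u' :=
    congr($((Scheme.ΓSpecIso (.of ℂ[T;T⁻¹])).hom_inv_id) u).symm
  obtain ⟨a, c, hac⟩ := exists_eq_C_mul_T_of_isUnit hu'
  have hz (z : ℂˣ) : (Φ.act _ y y (h z)).hom = smulEnd _ (scalar (a * ((z ^ c : ℂˣ) : ℂ))) := by
    have hy : Gm.point z ≫ toUnit Gm ≫ y = y := by
      rw [← Category.assoc, toUnit_unique (Gm.point z ≫ toUnit Gm) (𝟙 _), Category.id_comp]
    have h1 := Φ.act_comp (Gm.point z) l (toUnit Gm ≫ y) (toUnit Gm ≫ y) hl (by rw [hy, h])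
    have h2 := Φ.act_congr (Gm.point z ≫ l) hy hy (by rw [hy, h]) (h z)
    change (Scheme.Modules.pullback _).map A.hom ≫ _ = _ at h1
    rw [hu, pullback_map_smulEnd, smulEnd_naturality, cancel_epi, h2] at h1
    rw [eq_smulEnd_of_eqToHom _ h1, hu'', scalar_point_appTop, hac, map_mul, laurentEval_C,
      laurentEval_T]
  -- `λ(1)` is idempotent, so it acts by an idempotent automorphism, that is, by the identity; its
  -- multiplier is `a * 1 ^ c`.
  have ha : a = 1 := by
    have hone : (Gm.point 1 ≫ l) * (Gm.point 1 ≫ l) = Gm.point 1 ≫ l := by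
      rw [← MonObj.mul_comp, Gm.point_one_mul_point_one]
    have h1 := Φ.act_mul (Gm.point 1 ≫ l) (Gm.point 1 ≫ l) y y y (h 1) (h 1)
      (by rw [hone, h])
    have h2 : (Φ.act (Gm.point 1 ≫ l) y y (h 1)).hom = 𝟙 _ := by
      rw [← cancel_epi (Φ.act (Gm.point 1 ≫ l) y y (h 1)).hom, Category.comp_id]
      refine congr(($h1).hom).symm.trans ?_
      congr 2
    rw [hz, ← smulEnd_one] at h2
    have h3 := smulEnd_injective e h2
    rw [one_zpow, Units.val_one, mul_one, ← map_one (Scheme.ΓSpecIso (.of ℂ)).inv.hom] at h3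
    exact scalar_injective h3
  refine ⟨c, hasWeight_of_eq_smulEnd Φ h fun z => ?_⟩
  rw [hz, ha, one_mul]

/-- The trivialization `e` provides a generator of the fibre, on which scalars can be compared. The
single value `z = 2` is enough, since `n ↦ 2 ^ n` is injective on integers. -/
lemma HasWeight.unique {Φ : Linearization G L} {l : Gm ⟶ G} {y : Points X}
    (e : fibreSheaf L y ≅ structureModule SpecC)
    {c c' : ℤ} (h : HasWeight Φ l y c) (h' : HasWeight Φ l y c') : c = c' := by
  have h2 : (2 : ℂ) ≠ 0 := two_ne_zero
  obtain ⟨h₁, H⟩ := h (Units.mk0 2 h2)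
  obtain ⟨h₂, H'⟩ := h' (Units.mk0 2 h2)
  have hs (r : Γ(SpecC, ⊤)) :
      e.hom.app ⊤ (r • e.inv.app ⊤ (oneSection ⊤)) = r • oneSection ⊤ := by
    rw [Scheme.Modules.Hom.app_smul]
    exact congr(r • ($(e.inv_hom_id)).app ⊤ (oneSection ⊤))
  have hcc := scalar_injective (smul_oneSection_injective
    ((hs _).symm.trans (congrArg (e.hom.app ⊤) ((H _).symm.trans (H' _)) |>.trans (hs _))))
  rw [Units.val_zpow_eq_zpow_val, Units.val_zpow_eq_zpow_val, Units.val_mk0] at hcc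
  have hr : ((2 : ℝ) ^ c) = 2 ^ c' := Complex.ofReal_injective (by push_cast; exact hcc)
  exact zpow_right_injective₀ (by norm_num) (by norm_num) hr

/-- The induced linearization is the given one conjugated by the canonical isomorphism `y^* π^* L ≅
(π y)^* L`, and conjugation preserves scalars. -/
lemma HasWeight.pullback {Y : SchC} [ModObj G Y] (π : X ⟶ Y) [IsModHom G π] {L : Y.left.Modules}
    {Φ : Linearization G L} {l : Gm ⟶ G} {y : Points X} {c : ℤ}
    (hy : ∀ z, (Gm.point z ≫ l) • y = y) (h : HasWeight Φ l (y ≫ π) c) :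
    HasWeight (Φ.pullback π) l y c := fun z => by
  obtain ⟨h', H⟩ := h z
  refine ⟨hy z, fun s => ?_⟩
  let e := (Scheme.Modules.pullbackComp y.left π.left).app L
  have he : e.inv.app ⊤ (e.hom.app ⊤ s) = s := congr(($(e.hom_inv_id)).app ⊤ s)
  have hact : ((Φ.pullback π).act (Gm.point z ≫ l) y y (hy z)).hom =
      e.hom ≫ (Φ.act (Gm.point z ≫ l) (y ≫ π) (y ≫ π) h').hom ≫ e.inv := rfl
  rw [hact, Scheme.Modules.Hom.comp_app, Scheme.Modules.Hom.comp_app, comp_apply, comp_apply, H,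
    Scheme.Modules.Hom.app_smul, he]

lemma hasMu_iff {Φ : Linearization G L} {l : Gm ⟶ G} {x y : Points X} [IsSeparated X.hom]
    (e : fibreSheaf L y ≅ structureModule SpecC) {c : ℤ} (hlim : IsLimit l x y)
    (hc : HasWeight Φ l y c) {m : ℤ} : HasMu Φ l x m ↔ m = -c := by
  constructor
  · rintro ⟨y', c', hlim', hc', rfl⟩
    obtain rfl := hlim.unique hlim'
    rw [hc.unique e hc']
  · rintro rfl
    exact ⟨y, c, hlim, hc, rfl⟩

lemma existsUnique_hasMu {Φ : Linearization G L} {l : Gm ⟶ G} {x : Points X} {c : ℤ}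
    (h : ∀ m, HasMu Φ l x m ↔ m = -c) : (∃! m, HasMu Φ l x m) ∧ mu Φ l x = -c :=
  ⟨⟨-c, (h _).2 rfl, fun _ hm => (h _).1 hm⟩,
    (h _).1 (Classical.epsilon_spec (p := HasMu Φ l x) ⟨-c, (h _).2 rfl⟩)⟩

end Weight

end GIT

end

/-! ### Comparison of the two weights -/

theorem mainTheorem11 (G : GIT.SchC) [GrpObj G] (hG : GIT.IsReductive G)
    (X Y : GIT.SchC) [ModObj G X] [ModObj G Y]
    (hX : GIT.IsProjective X) (hY : GIT.IsProjective Y)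
    (π : X ⟶ Y) [IsModHom G π] (hπ : IsFinite π.left)
    (L : Y.left.Modules) (hL : GIT.IsAmple L) (Φ : GIT.Linearization G L)
    (x : GIT.Points X) (l : GIT.Gm ⟶ G) [IsMonHom l] :
    (∃! m : ℤ, GIT.HasMu (Φ.pullback π) l x m) ∧
    (∃! m : ℤ, GIT.HasMu Φ l (x ≫ π) m) ∧
    GIT.mu (Φ.pullback π) l x = GIT.mu Φ l (x ≫ π) := by
  have := hX.isProper
  have := hY.isProper
  obtain ⟨y, hy⟩ := GIT.exists_isLimit l x
  have hyπ := hy.comp π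
  -- The weight is constructed only at `π(y)` and transported to `y`, so both numbers are computed
  -- from the same `c`.
  obtain ⟨c, hc⟩ := GIT.exists_hasWeight hL.lineBundle Φ hyπ.point_smul
  obtain ⟨e⟩ := GIT.exists_pullback_iso_structureModule hL.lineBundle (y ≫ π).left
  obtain ⟨h₁, h₂⟩ := GIT.existsUnique_hasMu fun _ => GIT.hasMu_iff e hyπ hc
  obtain ⟨h₃, h₄⟩ := GIT.existsUnique_hasMu fun _ => GIT.hasMu_iff
    ((Scheme.Modules.pullbackComp y.left π.left).app L ≪≫ e) hy (hc.pullback π hy.point_smul)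
  exact ⟨h₃, h₁, h₄.trans h₂.symm⟩
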